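/- Let $d\ge 2$ be even. For real $m$ let $M(d,m)$ be the $(d+1)\times(d+1)$ circulant matrix whose columns $v^{(0)},\dots,v^{(d)}$ are the successive cyclic shifts (to the right) of $(1,m,0,\dots,0,-m)\in\mathbb R^{d+1}$, and let $S(d,m)=\operatorname{conv}(v^{(0)},\dots,v^{(d)})\subset\mathbb R^{d+1}$. Let $u=(u_0,\dots,u_d)$ be the first row of $\det(M(d,m))\cdot M(d,m)^{-1}$. For $k\ge 1$ let $c_k=c_k(m)$ be the continuant number, i.e. the determinant of the $k\times k$ tridiagonal matrix with all diagonal entries $1$, all entries just above the diagonal $-m$, and all entries just below the diagonal $m$. Let $e_0,\dots,e_d$ be the standard basis of $\mathbb R^{d+1}$. We say that $S(d,m)$ is an empty simplex if $v^{(0)},\dots,v^{(d)}$ are affinely independent and $S(d,m)$ contains no point of $\mathbb Z^{d+1}$ other than vertices; when $m$ is an integer all vertices $v^{(j)}$ lie in $\mathbb Z^{d+1}$, so $S(d,m)$ is then an empty lattice simplex in the usual sense. (a) For every real $m>0$ the following conditions are equivalent: (1) $m^{d-1}<c_{d-1}(m)$; (2) $u_d<0$; (3) $S(d,m)$ contains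 none of the standard basis vectors $e_0,\dots,e_d$ (equivalently, at least one of them is not in $S(d,m)$); (4) $S(d,m)$ is an empty simplex. (b) There is a unique positive real number $m_0(d)$ with $m_0(d)^{d-1}=c_{d-1}(m_0(d))$; it is also the unique positive solution $m$ of $u_d(m)=0$. If $0\le m<m_0(d)$, then $S(d,m)$ is an empty simplex. -/

import Mathlib

namespace CirculantSimplex

/-- The generator `(1, m, 0, …, 0, -m)`, a vector with `d + 1` coordinates (meant for `2 ≤ d`). -/
def generator (d : ℕ) (m : ℝ) : Fin (d + 1) → ℝ := fun k =>
  if k = 0 then 1 else if k = 1 then m else if k = Fin.last d then -m else 0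

/-- The circulant matrix `M(d,m)`, whose `j`-th column is the cyclic shift by `j` units to the
right of the generator. -/
def M (d : ℕ) (m : ℝ) : Matrix (Fin (d + 1)) (Fin (d + 1)) ℝ :=
  Matrix.circulant (generator d m)

/-- The `j`-th vertex `v^{(j)}` of `S(d,m)`: the `j`-th column of `M(d,m)`. -/
def vertex (d : ℕ) (m : ℝ) (j : Fin (d + 1)) : Fin (d + 1) → ℝ := fun i => M d m i j

/-- The circulant simplex `S(d,m)`. -/
def S (d : ℕ) (m : ℝ) : Set (Fin (d + 1) → ℝ) := convexHull ℝ (Set.range (vertex d m))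

/-- The vector `u = (u_0, …, u_d)`: the first row of `det M(d,m) • M(d,m)⁻¹`. -/
noncomputable def u (d : ℕ) (m : ℝ) : Fin (d + 1) → ℝ := ((M d m).det • (M d m)⁻¹) 0

/-- The `k × k` continuant matrix: tridiagonal, with `1` on the diagonal, `-m` just above it and
`m` just below it. -/
def continuantMatrix (k : ℕ) (m : ℝ) : Matrix (Fin k) (Fin k) ℝ := fun i j =>
  if i = j then 1
  else if (j : ℕ) = (i : ℕ) + 1 then -m
  else if (i : ℕ) = (j : ℕ) + 1 then m
  else 0

/-- The continuant number `c_k(m)`. -/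
def c (k : ℕ) (m : ℝ) : ℝ := (continuantMatrix k m).det

/-- A point with integer coordinates. -/
def IsLatticePoint {κ : Type*} (x : κ → ℝ) : Prop := ∀ i, ∃ z : ℤ, x i = (z : ℝ)

/-- The points `p i` are the vertices of a simplex whose only lattice points, if any, are
vertices. The vertices are not required to be lattice points, so that the notion makes
sense for a real parameter; for lattice simplices it is the usual notion of empty simplex. -/
def IsEmptySimplex {ι κ : Type*} (p : ι → κ → ℝ) : Prop :=
  AffineIndependent ℝ p ∧
    ∀ x ∈ convexHull ℝ (Set.range p), IsLatticePoint x → x ∈ Set.range p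

end CirculantSimplex

namespace CirculantSimplex

/-! Every condition reduces to `1 < fibPoly m⁻¹ d`. Write t = 1/m and F_k = `fibPoly t k`. Rescaling
continuants gives c_k = m^k F_{k+1}. As (M f)_i = f_i + m (f_{i-1} - f_{i+1}), the first column w of
M⁻¹ obeys a Fibonacci recurrence with period d + 1. Its entry w_1 is a positive multiple of 1 - F_d,
and w_1 is the smallest entry when negative; this settles `u` and the points e_i.

For emptiness, let M l be a lattice point of S, with r and f the integral and fractional parts of m
l. The numbers l_i + f_{i-1} - f_{i+1} are integers above -1 with sum 1, so they form some e_q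
(`exists_floor_equation`). Hence M f = m e_q - r; inverting, w_1 < 0 forces f = 0 and l = e_q.

The threshold exists because F_d increases strictly from 0 in t. -/

variable {d : ℕ} {m : ℝ}

/-- The Fibonacci polynomials, as functions of a real variable. -/
def fibPoly (t : ℝ) : ℕ → ℝ
  | 0 => 0
  | 1 => 1
  | k + 2 => fibPoly t k + t * fibPoly t (k + 1)

@[simp] theorem fibPoly_zero (t : ℝ) : fibPoly t 0 = 0 := rfl

@[simp] theorem fibPoly_one (t : ℝ) : fibPoly t 1 = 1 := rfl

theorem fibPoly_add_two (t : ℝ) (k : ℕ) :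
    fibPoly t (k + 2) = fibPoly t k + t * fibPoly t (k + 1) := rfl

theorem fibPoly_nonneg {t : ℝ} (ht : 0 ≤ t) : ∀ k, 0 ≤ fibPoly t k
  | 0 => le_rfl
  | 1 => zero_le_one
  | k + 2 => add_nonneg (fibPoly_nonneg ht k) (mul_nonneg ht (fibPoly_nonneg ht (k + 1)))

theorem fibPoly_pos {t : ℝ} (ht : 0 < t) : ∀ k, 0 < k → 0 < fibPoly t k
  | 1, _ => one_pos
  | k + 2, _ => add_pos_of_nonneg_of_pos (fibPoly_nonneg ht.le k)
      (mul_pos ht (fibPoly_pos ht (k + 1) k.succ_pos))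

theorem continuous_fibPoly : ∀ k, Continuous fun t => fibPoly t k
  | 0 => continuous_const
  | 1 => continuous_const
  | k + 2 => (continuous_fibPoly k).add (continuous_id.mul (continuous_fibPoly (k + 1)))

theorem fibPoly_mono {s t : ℝ} (hs : 0 ≤ s) (hst : s ≤ t) : ∀ k, fibPoly s k ≤ fibPoly t k
  | 0 => le_rfl
  | 1 => le_rfl
  | k + 2 => add_le_add (fibPoly_mono hs hst k)
      (mul_le_mul hst (fibPoly_mono hs hst (k + 1)) (fibPoly_nonneg hs _) (hs.trans hst))

/-- Evenness excludes k = 1, where the polynomial is constant. -/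
theorem fibPoly_even_lt {s t : ℝ} (hs : 0 ≤ s) (hst : s < t) {k : ℕ} (hk : Even k) (hk0 : 0 < k) :
    fibPoly s k < fibPoly t k := by
  obtain ⟨i, rfl⟩ : ∃ i, k = i + 2 := ⟨k - 2, by obtain ⟨r, rfl⟩ := hk; omega⟩
  rw [fibPoly_add_two, fibPoly_add_two]
  have hpos : 0 < fibPoly t (i + 1) := fibPoly_pos (hs.trans_lt hst) _ i.succ_pos
  have h1 := fibPoly_mono hs hst.le i
  have h2 := fibPoly_mono hs hst.le (i + 1)
  nlinarith [mul_le_mul_of_nonneg_left h2 hs]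

theorem fibPoly_at_zero_even (i : ℕ) : fibPoly 0 (2 * i) = 0 := by
  induction i with
  | zero => rfl
  | succ i ih => rw [Nat.mul_succ, fibPoly_add_two, ih]; simp

theorem one_le_fibPoly_one : ∀ k, 0 < k → 1 ≤ fibPoly 1 k
  | 1, _ => le_rfl
  | k + 2, _ => by
    rw [fibPoly_add_two]
    linarith [fibPoly_nonneg zero_le_one k, one_le_fibPoly_one (k + 1) k.succ_pos]

/-! ### Continuants -/

theorem c_zero (m : ℝ) : c 0 m = 1 := by simp [c]

theorem c_one (m : ℝ) : c 1 m = 1 := by simp [c, continuantMatrix]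

theorem c_add_two (k : ℕ) (m : ℝ) : c (k + 2) m = c (k + 1) m + m ^ 2 * c k m := by
  have hcc : ∀ (n : ℕ) (i j : Fin n),
      continuantMatrix (n + 1) m i.succ j.succ = continuantMatrix n m i j := by
    intro n i j
    simp [continuantMatrix]
  have h0 : ((continuantMatrix (k + 2) m).submatrix Fin.succ (Fin.succAbove 0)) =
      continuantMatrix (k + 1) m := by
    ext i j
    simp [hcc]
  -- The second minor of the first row has a first column with the single nonzero entry `m`.
  have h1 : ((continuantMatrix (k + 2) m).submatrix Fin.succ (Fin.succAbove (Fin.succ 0))).det =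
      m * c k m := by
    rw [Matrix.det_succ_column_zero, Fin.sum_univ_succ, Finset.sum_eq_zero, c]
    · have : (((continuantMatrix (k + 2) m).submatrix Fin.succ
          (Fin.succAbove (Fin.succ 0))).submatrix (Fin.succAbove 0) Fin.succ) =
          continuantMatrix k m := by
        ext i j
        simp [hcc]
      rw [this]
      simp [continuantMatrix]
    · intro i _
      simp [continuantMatrix]
  rw [c, Matrix.det_succ_row_zero, Fin.sum_univ_succ, Fin.sum_univ_succ, Finset.sum_eq_zero,
    h0, h1, ← c]
  · simp [continuantMatrix]
    ring
  · intro i _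
    simp [continuantMatrix, Fin.ext_iff]

theorem c_eq_pow_mul_fibPoly {m : ℝ} (hm : m ≠ 0) :
    ∀ k, c k m = m ^ k * fibPoly m⁻¹ (k + 1)
  | 0 => by simp [c_zero]
  | 1 => by simp [c_one, fibPoly_add_two, hm]
  | k + 2 => by
    rw [c_add_two, c_eq_pow_mul_fibPoly hm k, c_eq_pow_mul_fibPoly hm (k + 1),
      fibPoly_add_two _ (k + 1)]
    field_simp
    ring

/-! ### The circulant matrix -/

theorem last_eq_neg_one (d : ℕ) : Fin.last d = -1 :=
  Fin.ext Fin.coe_neg_one.symm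

theorem sum_M_mul (hd : 2 ≤ d) (m : ℝ) (f : Fin (d + 1) → ℝ) (i : Fin (d + 1)) :
    ∑ j, M d m i j * f j = f i + m * (f (i - 1) - f (i + 1)) := by
  obtain ⟨e, rfl⟩ : ∃ e, d = e + 2 := ⟨d - 2, by omega⟩
  have h01 : (1 : Fin (e + 2 + 1)) ≠ 0 := by simp
  have hl0 : Fin.last (e + 2) ≠ 0 := by simp [Fin.ext_iff]
  have hl1 : Fin.last (e + 2) ≠ 1 := by simp [Fin.ext_iff]
  have hl : i - Fin.last (e + 2) = i + 1 := by
    rw [last_eq_neg_one, sub_neg_eq_add]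
  have hg : ∀ k, generator (e + 2) m k = (if k = 0 then 1 else 0) + (if k = 1 then m else 0) +
      (if k = Fin.last (e + 2) then -m else 0) := by
    intro k
    unfold generator
    split_ifs <;> simp_all
  rw [← Equiv.sum_comp (Equiv.subLeft i)]
  simp only [M, Matrix.circulant_apply, Equiv.subLeft_apply, sub_sub_cancel, hg, add_mul,
    Finset.sum_add_distrib, ite_mul, zero_mul, Finset.sum_ite_eq', Finset.mem_univ, if_true,
    one_mul, sub_zero, hl]
  ring

theorem M_mulVec (hd : 2 ≤ d) (m : ℝ) (f : Fin (d + 1) → ℝ) (i : Fin (d + 1)) :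
    (M d m).mulVec f i = f i + m * (f (i - 1) - f (i + 1)) :=
  sum_M_mul hd m f i

theorem sum_sub_one_add_one (f : Fin (d + 1) → ℝ) :
    ∑ i, (f (i - 1) - f (i + 1)) = 0 := by
  have h1 := Equiv.sum_comp (Equiv.subRight (1 : Fin (d + 1))) f
  have h2 := Equiv.sum_comp (Equiv.addRight (1 : Fin (d + 1))) f
  simp only [Equiv.subRight_apply, Equiv.coe_addRight] at h1 h2
  rw [Finset.sum_sub_distrib, h1, h2, sub_self]

theorem sum_M_mulVec (hd : 2 ≤ d) (m : ℝ) (f : Fin (d + 1) → ℝ) :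
    ∑ i, (M d m).mulVec f i = ∑ i, f i := by
  simp only [M_mulVec hd, Finset.sum_add_distrib, ← Finset.mul_sum, sum_sub_one_add_one,
    mul_zero, add_zero]

theorem S_eq_image (d : ℕ) (m : ℝ) :
    S d m = (M d m).mulVec '' stdSimplex ℝ (Fin (d + 1)) := by
  have h := (M d m).mulVecLin.image_convexHull
    (Set.range fun i : Fin (d + 1) => (Pi.single i 1 : Fin (d + 1) → ℝ))
  rw [convexHull_rangle_single_eq_stdSimplex, ← Set.range_comp] at h
  rw [S, ← Matrix.coe_mulVecLin, h]
  congr 2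
  ext j i
  simp [vertex]

/-! ### The inverse of the circulant matrix -/

/-- A multiple of the first column of the inverse of `M d m`, with `t = 1 / m`. -/
def invSeq (d : ℕ) (t : ℝ) (k : ℕ) : ℝ := fibPoly t k + (-1) ^ k * fibPoly t (d + 1 - k)

/-- Reversing the index of a Fibonacci solution and alternating its signs gives another solution.
The sum of the two agrees at 0 and d + 1, so it closes up cyclically. -/
theorem invSeq_add_two (t : ℝ) {k : ℕ} (hk : k + 2 ≤ d + 1) :
    invSeq d t (k + 2) = invSeq d t k + t * invSeq d t (k + 1) := by
  obtain ⟨e, he⟩ := Nat.exists_eq_add_of_le hk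
  have h1 : d + 1 - (k + 2) = e := by omega
  have h2 : d + 1 - (k + 1) = e + 1 := by omega
  have h3 : d + 1 - k = e + 2 := by omega
  rw [invSeq, invSeq, invSeq, h1, h2, h3, fibPoly_add_two, fibPoly_add_two]
  ring

theorem invSeq_zero (d : ℕ) (t : ℝ) : invSeq d t 0 = fibPoly t (d + 1) := by
  simp [invSeq]

theorem invSeq_last (d : ℕ) (t : ℝ) : invSeq d t (d + 1) = fibPoly t (d + 1) := by
  simp [invSeq]

theorem invSeq_one (d : ℕ) (t : ℝ) : invSeq d t 1 = 1 - fibPoly t d := by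
  simp [invSeq]
  ring

theorem invSeq_self (hd : Even d) (t : ℝ) : invSeq d t d = fibPoly t d + 1 := by
  simp [invSeq, hd.neg_one_pow]

theorem invSeq_even_pos {t : ℝ} (ht : 0 < t) {k : ℕ} (hk : Even k) (hkd : k ≤ d) :
    0 < invSeq d t k := by
  rw [invSeq, hk.neg_one_pow, one_mul]
  exact add_pos_of_nonneg_of_pos (fibPoly_nonneg ht.le k) (fibPoly_pos ht _ (by omega))

/-- Each step between odd indices adds t times a positive even-indexed term. -/
theorem invSeq_one_le {t : ℝ} (ht : 0 < t) (i : ℕ) (hi : 2 * i + 1 ≤ d + 1) :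
    invSeq d t 1 ≤ invSeq d t (2 * i + 1) := by
  induction i with
  | zero => exact le_rfl
  | succ i ih =>
    rw [show 2 * (i + 1) + 1 = 2 * i + 1 + 2 by ring, invSeq_add_two t (by omega)]
    have := invSeq_even_pos (d := d) ht (k := 2 * i + 1 + 1) ⟨i + 1, by ring⟩ (by omega)
    nlinarith [ih (by omega)]

theorem invSeq_nonneg {t : ℝ} (ht : 0 < t) (h : 0 ≤ invSeq d t 1) {k : ℕ} (hk : k ≤ d) :
    0 ≤ invSeq d t k := by
  rcases Nat.even_or_odd k with hk' | ⟨i, rfl⟩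
  · exact (invSeq_even_pos ht hk' hk).le
  · exact h.trans (invSeq_one_le ht i (by omega))

theorem invSeq_one_le_of_neg {t : ℝ} (ht : 0 < t) (h : invSeq d t 1 < 0) {k : ℕ} (hk : k ≤ d) :
    invSeq d t 1 ≤ invSeq d t k := by
  rcases Nat.even_or_odd k with hk' | ⟨i, rfl⟩
  · exact h.le.trans (invSeq_even_pos ht hk' hk).le
  · exact invSeq_one_le ht i (by omega)

/-- The determinant of `M d m`, up to the factor `m ^ d`. -/
noncomputable def invDenom (d : ℕ) (m : ℝ) : ℝ := fibPoly m⁻¹ (d + 1) + 2 * m * fibPoly m⁻¹ d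

theorem invDenom_pos (d : ℕ) (hm : 0 < m) : 0 < invDenom d m :=
  add_pos_of_pos_of_nonneg (fibPoly_pos (inv_pos.2 hm) _ d.succ_pos)
    (mul_nonneg (by positivity) (fibPoly_nonneg (inv_pos.2 hm).le d))

/-- The first column of the inverse of `M d m`. -/
noncomputable def invCol (d : ℕ) (m : ℝ) (k : Fin (d + 1)) : ℝ :=
  invSeq d m⁻¹ k / invDenom d m

theorem invCol_one (hd0 : 0 < d) : invCol d m 1 = (1 - fibPoly m⁻¹ d) / invDenom d m := by
  obtain ⟨e, rfl⟩ : ∃ e, d = e + 1 := ⟨d - 1, by omega⟩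
  rw [invCol, ← invSeq_one]
  simp

theorem M_mulVec_invCol (hd : Even d) (hm : 0 < m) (i : Fin (d + 1)) :
    invCol d m i + m * (invCol d m (i - 1) - invCol d m (i + 1)) = if i = 0 then 1 else 0 := by
  have hD := (invDenom_pos d hm).ne'
  have key : invSeq d m⁻¹ i +
      m * (invSeq d m⁻¹ (i - 1 : Fin (d + 1)) - invSeq d m⁻¹ (i + 1 : Fin (d + 1))) =
      if i = 0 then invDenom d m else 0 := by
    -- The wrap from d to 0 is harmless, since `invSeq` agrees at 0 and d + 1. Only row 0, where i -
    -- 1 wraps, breaks the recurrence.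
    have hadd : invSeq d m⁻¹ (i + 1 : Fin (d + 1)) = invSeq d m⁻¹ (i + 1 : ℕ) := by
      rw [Fin.val_add_one]
      split_ifs with h
      · rw [h, Fin.val_last, invSeq_zero, invSeq_last]
      · rfl
    rw [hadd]
    split_ifs with h
    · subst h
      rw [zero_sub, Fin.coe_neg_one, Fin.val_zero, invSeq_self hd, invSeq_zero, zero_add,
        invSeq_one, invDenom]
      ring
    · have h0 : (i : ℕ) ≠ 0 := fun h' => h (Fin.ext h')
      rw [Fin.val_sub_one_of_ne_zero h]
      obtain ⟨k, hk⟩ := Nat.exists_eq_succ_of_ne_zero h0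
      have := i.isLt
      rw [hk, Nat.succ_eq_add_one, Nat.add_sub_cancel, invSeq_add_two _ (by omega)]
      field_simp
      ring
  unfold invCol
  rw [← sub_div, mul_div_assoc', ← add_div, key]
  split_ifs
  · exact div_self hD
  · exact zero_div _

theorem M_mul_circulant (hd : Even d) (hd0 : 0 < d) (hm : 0 < m) :
    M d m * Matrix.circulant (invCol d m) = 1 := by
  have hd2 : 2 ≤ d := by obtain ⟨r, rfl⟩ := hd; omega
  ext i j
  have h := M_mulVec_invCol hd hm (i - j)
  rw [Matrix.mul_apply, sum_M_mul hd2 m fun k => Matrix.circulant (invCol d m) k j]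
  simp only [Matrix.circulant_apply, Matrix.one_apply]
  rw [sub_right_comm, sub_add_eq_add_sub] at h
  rw [h]
  simp [sub_eq_zero]

theorem M_inv (hd : Even d) (hd0 : 0 < d) (hm : 0 < m) :
    (M d m)⁻¹ = Matrix.circulant (invCol d m) :=
  Matrix.inv_eq_right_inv (M_mul_circulant hd hd0 hm)

theorem circulant_mul_M (hd : Even d) (hd0 : 0 < d) (hm : 0 < m) :
    Matrix.circulant (invCol d m) * M d m = 1 :=
  mul_eq_one_comm.1 (M_mul_circulant hd hd0 hm)

theorem isUnit_M (hd : Even d) (hd0 : 0 < d) (hm : 0 < m) : IsUnit (M d m) :=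
  IsUnit.of_mul_eq_one _ (M_mul_circulant hd hd0 hm)

theorem M_zero (hd : 2 ≤ d) : M d 0 = 1 := by
  ext i j
  have := sum_M_mul hd 0 (Pi.single j 1) i
  simpa [Pi.single_apply, Matrix.one_apply] using this

theorem continuous_M (hd : 2 ≤ d) : Continuous (M d) := by
  refine continuous_matrix fun i j => ?_
  have h : (fun m => M d m i j) = fun m => (Pi.single j 1 : Fin (d + 1) → ℝ) i +
      m * ((Pi.single j 1 : Fin (d + 1) → ℝ) (i - 1) - (Pi.single j 1 : Fin (d + 1) → ℝ) (i + 1)) := by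
    ext m
    rw [← sum_M_mul hd m]
    simp [Pi.single_apply]
  rw [h]
  fun_prop

/-- The determinant is 1 at m = 0, continuous, and never zero for m > 0. -/
theorem det_M_pos (hd : Even d) (hd0 : 0 < d) (hm : 0 < m) : 0 < (M d m).det := by
  have hd2 : 2 ≤ d := by obtain ⟨r, rfl⟩ := hd; omega
  by_contra! hneg
  obtain ⟨s, hs, hs0⟩ := intermediate_value_Icc' hm.le
    (f := fun s => (M d s).det) (continuous_M hd2).matrix_det.continuousOn
    ⟨hneg, by simp [M_zero hd2]⟩
  rcases hs.1.eq_or_lt with h | h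
  · simp [← h, M_zero hd2] at hs0
  · exact ((Matrix.isUnit_iff_isUnit_det _).1 (isUnit_M hd hd0 h)).ne_zero hs0

theorem u_last (hd : Even d) (hd0 : 0 < d) (hm : 0 < m) :
    u d m (Fin.last d) = (M d m).det * ((1 - fibPoly m⁻¹ d) / invDenom d m) := by
  have h : (0 : Fin (d + 1)) - Fin.last d = 1 := by
    rw [last_eq_neg_one, zero_sub, neg_neg]
  simp only [u, M_inv hd hd0 hm, Matrix.smul_apply, Matrix.circulant_apply, h, invCol_one hd0,
    smul_eq_mul]

theorem pow_sub_c (hd0 : 0 < d) (hm : 0 < m) :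
    m ^ (d - 1) - c (d - 1) m = m ^ (d - 1) * (1 - fibPoly m⁻¹ d) := by
  rw [c_eq_pow_mul_fibPoly hm.ne', Nat.sub_add_cancel hd0]
  ring

theorem single_mem_S_iff (hd : Even d) (hd0 : 0 < d) (hm : 0 < m) (i : Fin (d + 1)) :
    (Pi.single i 1 : Fin (d + 1) → ℝ) ∈ S d m ↔ fibPoly m⁻¹ d ≤ 1 := by
  have hd2 : 2 ≤ d := by obtain ⟨r, rfl⟩ := hd; omega
  have hD := invDenom_pos d hm
  rw [S_eq_image]
  constructor
  · rintro ⟨l, hl, hli⟩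
    have h : l = (Matrix.circulant (invCol d m)).mulVec (Pi.single i 1) := by
      rw [← hli, Matrix.mulVec_mulVec, circulant_mul_M hd hd0 hm, Matrix.one_mulVec]
    -- Barycentric coordinate i + 1 of e_i is the critical entry w_1.
    have h1 := hl.1 (i + 1)
    rw [h, Matrix.mulVec_single_one, Matrix.col_apply, Matrix.circulant_apply, add_sub_cancel_left,
      invCol_one hd0] at h1
    rw [le_div_iff₀ hD] at h1
    linarith
  · intro hle
    refine ⟨(Matrix.circulant (invCol d m)).mulVec (Pi.single i 1), ⟨fun k => ?_, ?_⟩, ?_⟩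
    · rw [Matrix.mulVec_single_one, Matrix.col_apply, Matrix.circulant_apply]
      refine div_nonneg (invSeq_nonneg (inv_pos.2 hm) ?_ (Nat.lt_succ_iff.1 (Fin.isLt _))) hD.le
      rw [invSeq_one]
      linarith
    · rw [← sum_M_mulVec hd2 m, Matrix.mulVec_mulVec, M_mul_circulant hd hd0 hm, Matrix.one_mulVec]
      simp
    · rw [Matrix.mulVec_mulVec, M_mul_circulant hd hd0 hm, Matrix.one_mulVec]

/-! ### Lattice points -/

theorem exists_eq_single_of_sum_eq_one {ι : Type*} [Fintype ι] [DecidableEq ι] {f : ι → ℤ}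
    (hf : ∀ i, 0 ≤ f i) (hsum : ∑ i, f i = 1) : ∃ q, ∀ i, f i = if i = q then 1 else 0 := by
  obtain ⟨q, hq⟩ : ∃ q, 0 < f q := by
    by_contra! h
    have := Finset.sum_nonpos fun i (_ : i ∈ Finset.univ) => h i
    omega
  have hrest := Finset.sum_nonneg fun i (_ : i ∈ Finset.univ.erase q) => hf i
  have hsplit := Finset.add_sum_erase Finset.univ f (Finset.mem_univ q)
  refine ⟨q, fun i => ?_⟩
  split_ifs with h
  · subst h
    omega
  · have := Finset.single_le_sum (fun i (_ : i ∈ Finset.univ.erase q) => hf i)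
      (Finset.mem_erase.2 ⟨h, Finset.mem_univ i⟩)
    have := hf i
    omega

theorem mulVec_single_mem_range_vertex (d : ℕ) (m : ℝ) (q : Fin (d + 1)) :
    (M d m).mulVec (Pi.single q 1) ∈ Set.range (vertex d m) :=
  ⟨q, by ext i; simp [vertex]⟩

theorem affineIndependent_vertex (h : IsUnit (M d m)) : AffineIndependent ℝ (vertex d m) := by
  have := Matrix.linearIndependent_cols_iff_isUnit.2 h
  exact this.affineIndependent

theorem fract_add_sub_nonneg {a b l : ℝ} (hl : 0 ≤ l) {z : ℤ}
    (h : (z : ℝ) = l + (Int.fract a - Int.fract b)) : 0 ≤ z := by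
  have h1 := Int.fract_nonneg a
  have h2 := Int.fract_lt_one b
  have : (-1 : ℝ) < z := by linarith
  have : -1 < z := by exact_mod_cast this
  omega

/-- The fractional parts of `m` times the barycentric coordinates of a lattice point of `S d m`
satisfy the equations defining the vertices, up to the nonnegative vector of integral parts. -/
theorem exists_floor_equation (hd : 2 ≤ d) {l : Fin (d + 1) → ℝ}
    (hl : l ∈ stdSimplex ℝ (Fin (d + 1))) (hlat : IsLatticePoint ((M d m).mulVec l)) :
    ∃ q, ∀ i, l i + (Int.fract (m * l (i - 1)) - Int.fract (m * l (i + 1))) =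
      if i = q then 1 else 0 := by
  choose x hx using hlat
  have heq : ∀ i, ((x i - ⌊m * l (i - 1)⌋ + ⌊m * l (i + 1)⌋ : ℤ) : ℝ) =
      l i + (Int.fract (m * l (i - 1)) - Int.fract (m * l (i + 1))) := by
    intro i
    push_cast
    rw [← hx, M_mulVec hd, Int.fract, Int.fract]
    ring
  obtain ⟨q, hq⟩ := exists_eq_single_of_sum_eq_one
    (f := fun i => x i - ⌊m * l (i - 1)⌋ + ⌊m * l (i + 1)⌋)
    (fun i => fract_add_sub_nonneg (hl.1 i) (heq i)) (by
      have : (∑ i, ((x i - ⌊m * l (i - 1)⌋ + ⌊m * l (i + 1)⌋ : ℤ) : ℝ)) = 1 := by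
        -- The fractional parts cancel cyclically, leaving the sum of the l_i.
        simp only [heq, Finset.sum_add_distrib,
          sum_sub_one_add_one fun i => Int.fract (m * l i), add_zero]
        exact hl.2
      exact_mod_cast this)
  refine ⟨q, fun i => ?_⟩
  rw [← heq, hq]
  split_ifs <;> simp

theorem isEmptySimplex_vertex_of_pos (hd : Even d) (hd0 : 0 < d) (hm : 0 < m)
    (hfib : 1 < fibPoly m⁻¹ d) : IsEmptySimplex (vertex d m) := by
  have hd2 : 2 ≤ d := by obtain ⟨r, rfl⟩ := hd; omega
  have hD := invDenom_pos d hm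
  refine ⟨affineIndependent_vertex (isUnit_M hd hd0 hm), fun x hx hlat => ?_⟩
  change x ∈ S d m at hx
  rw [S_eq_image] at hx
  obtain ⟨l, hl, rfl⟩ := hx
  obtain ⟨q, hq⟩ := exists_floor_equation hd2 hl hlat
  set f : Fin (d + 1) → ℝ := fun i => Int.fract (m * l i) with hf
  have hf0 : ∀ i, 0 ≤ f i := fun i => Int.fract_nonneg _
  have hfl : ∀ i, (⌊m * l i⌋ : ℝ) + f i = m * l i := fun i => Int.floor_add_fract _
  have hr0 : ∀ i, (0 : ℝ) ≤ ⌊m * l i⌋ := fun i => by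
    exact_mod_cast Int.floor_nonneg.2 (mul_nonneg hm.le (hl.1 i))
  have hMf : (M d m).mulVec f = fun i => m * (if i = q then 1 else 0) - ⌊m * l i⌋ := by
    ext i
    rw [M_mulVec hd2, ← hq]
    linear_combination hfl i
  have hneg : invCol d m 1 < 0 := by
    rw [invCol_one hd0]
    exact div_neg_of_neg_of_pos (by linarith) hD
  have hmin : ∀ k, invCol d m 1 ≤ invCol d m k := by
    intro k
    rw [invCol_one hd0, ← invSeq_one, invCol]
    refine div_le_div_of_nonneg_right (invSeq_one_le_of_neg (inv_pos.2 hm) ?_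
      (Nat.lt_succ_iff.1 k.isLt)) hD.le
    rw [invSeq_one]
    linarith
  -- Coordinate q + 1 is chosen so that e_q contributes exactly m w_1.
  have hfq : f (q + 1) = m * invCol d m 1 - ∑ j, invCol d m (q + 1 - j) * ⌊m * l j⌋ := by
    have h : f = (Matrix.circulant (invCol d m)).mulVec ((M d m).mulVec f) := by
      rw [Matrix.mulVec_mulVec, circulant_mul_M hd hd0 hm, Matrix.one_mulVec]
    rw [congrFun h (q + 1), hMf]
    simp only [Matrix.mulVec, dotProduct, Matrix.circulant_apply, mul_sub,
      Finset.sum_sub_distrib]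
    simp [mul_comm]
  have hsumle : invCol d m 1 * ∑ j, (⌊m * l j⌋ : ℝ) ≤
      ∑ j, invCol d m (q + 1 - j) * ⌊m * l j⌋ := by
    rw [Finset.mul_sum]
    exact Finset.sum_le_sum fun j _ => mul_le_mul_of_nonneg_right (hmin _) (hr0 j)
  have hsum : ∑ j, (⌊m * l j⌋ : ℝ) + ∑ j, f j = m := by
    rw [← Finset.sum_add_distrib, Finset.sum_congr rfl fun j _ => hfl j, ← Finset.mul_sum, hl.2,
      mul_one]
  have hfsum : ∑ j, f j = 0 := by
    refine le_antisymm ?_ (Finset.sum_nonneg fun j _ => hf0 j)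
    have := hf0 (q + 1)
    -- The bounds give 0 ≤ f (q + 1) ≤ w_1 (m - ∑ r) = w_1 ∑ f with w_1 < 0.
    nlinarith
  have hfz : ∀ i, f i = 0 := fun i =>
    (Finset.sum_eq_zero_iff_of_nonneg fun j _ => hf0 j).1 hfsum i (Finset.mem_univ i)
  have hlq : l = Pi.single q 1 := by
    ext i
    have h1 := hq i
    have h2 := hfz (i - 1)
    have h3 := hfz (i + 1)
    simp only [hf] at h2 h3
    rw [h2, h3, sub_zero, add_zero] at h1
    rw [h1, Pi.single_apply]
  rw [hlq]
  exact mulVec_single_mem_range_vertex d m q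

theorem isEmptySimplex_vertex_zero (hd : 2 ≤ d) : IsEmptySimplex (vertex d 0) := by
  refine ⟨affineIndependent_vertex (M_zero hd ▸ isUnit_one), fun x hx hlat => ?_⟩
  change x ∈ S d 0 at hx
  rw [S_eq_image] at hx
  obtain ⟨l, hl, rfl⟩ := hx
  obtain ⟨q, hq⟩ := exists_floor_equation hd hl hlat
  have hlq : l = Pi.single q 1 := by
    ext i
    simpa [Pi.single_apply] using hq i
  rw [hlq]
  exact mulVec_single_mem_range_vertex d 0 q

theorem single_notMem_range_vertex (hd : 2 ≤ d) (hm : m ≠ 0) (i : Fin (d + 1)) :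
    (Pi.single i 1 : Fin (d + 1) → ℝ) ∉ Set.range (vertex d m) := by
  rintro ⟨j, hj⟩
  obtain ⟨e, rfl⟩ : ∃ e, d = e + 2 := ⟨d - 2, by omega⟩
  have h0 := congrFun hj j
  have h1 := congrFun hj (j + 1)
  simp only [vertex, M, Matrix.circulant_apply, sub_self, add_sub_cancel_left, generator,
    if_true, Pi.single_apply] at h0 h1
  have h10 : (1 : Fin (e + 2 + 1)) ≠ 0 := by simp
  rw [if_neg h10] at h1
  split_ifs at h0 h1 with h2 h3
  · exact h10 (add_eq_left.1 (h3.trans h2.symm))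
  · exact hm h1
  · exact zero_ne_one h0.symm
  · exact hm h1

theorem isLatticePoint_vertex_intCast (d : ℕ) (m : ℤ) (j : Fin (d + 1)) :
    IsLatticePoint (vertex d (m : ℝ) j) := by
  intro i
  simp only [vertex, M, Matrix.circulant_apply, generator]
  split_ifs
  · exact ⟨1, by simp⟩
  · exact ⟨m, rfl⟩
  · exact ⟨-m, by simp⟩
  · exact ⟨0, by simp⟩

theorem isLatticePoint_single (i : Fin (d + 1)) :
    IsLatticePoint (Pi.single i 1 : Fin (d + 1) → ℝ) := by
  intro j
  rw [Pi.single_apply]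
  split_ifs
  · exact ⟨1, by simp⟩
  · exact ⟨0, by simp⟩

/-! ### Reduction of the conditions to `fibPoly m⁻¹ d`, and the threshold -/

theorem isEmptySimplex_vertex_iff (hd : Even d) (hd0 : 0 < d) (hm : 0 < m) :
    IsEmptySimplex (vertex d m) ↔ 1 < fibPoly m⁻¹ d := by
  refine ⟨fun h => ?_, isEmptySimplex_vertex_of_pos hd hd0 hm⟩
  have hd2 : 2 ≤ d := by obtain ⟨r, rfl⟩ := hd; omega
  by_contra! hle
  exact single_notMem_range_vertex hd2 hm.ne' 0
    (h.2 _ ((single_mem_S_iff hd hd0 hm 0).2 hle) (isLatticePoint_single 0))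

theorem pow_lt_c_iff (hd0 : 0 < d) (hm : 0 < m) :
    m ^ (d - 1) < c (d - 1) m ↔ 1 < fibPoly m⁻¹ d := by
  rw [← sub_neg, pow_sub_c hd0 hm, ← smul_eq_mul, smul_neg_iff_of_pos_left (pow_pos hm _), sub_neg]

theorem pow_eq_c_iff (hd0 : 0 < d) (hm : 0 < m) :
    m ^ (d - 1) = c (d - 1) m ↔ fibPoly m⁻¹ d = 1 := by
  rw [← sub_eq_zero, pow_sub_c hd0 hm, mul_eq_zero_iff_left (pow_pos hm _).ne', sub_eq_zero,
    eq_comm]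

theorem u_last_neg_iff (hd : Even d) (hd0 : 0 < d) (hm : 0 < m) :
    u d m (Fin.last d) < 0 ↔ 1 < fibPoly m⁻¹ d := by
  rw [u_last hd hd0 hm, ← smul_eq_mul, smul_neg_iff_of_pos_left (det_M_pos hd hd0 hm),
    div_lt_iff₀ (invDenom_pos d hm), zero_mul, sub_neg]

theorem u_last_eq_zero_iff (hd : Even d) (hd0 : 0 < d) (hm : 0 < m) :
    u d m (Fin.last d) = 0 ↔ fibPoly m⁻¹ d = 1 := by
  rw [u_last hd hd0 hm, mul_eq_zero_iff_left (det_M_pos hd hd0 hm).ne',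
    div_eq_zero_iff, or_iff_left (invDenom_pos d hm).ne', sub_eq_zero, eq_comm]

/-- Intermediate values on [0, 1]; evenness of d makes the value at 0 vanish. -/
theorem exists_fibPoly_eq_one (hd : Even d) (hd0 : 0 < d) : ∃ t, 0 < t ∧ fibPoly t d = 1 := by
  have h0 : fibPoly 0 d = 0 := by
    obtain ⟨r, rfl⟩ := hd
    rw [← two_mul, fibPoly_at_zero_even]
  obtain ⟨t, ht, ht1⟩ := intermediate_value_Icc (zero_le_one (α := ℝ))
    (continuous_fibPoly d).continuousOn
    ⟨h0.trans_le zero_le_one, one_le_fibPoly_one d hd0⟩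
  refine ⟨t, ht.1.lt_of_ne fun h => ?_, ht1⟩
  simp only [← h, h0, zero_ne_one] at ht1

end CirculantSimplex

theorem theorem4p5 (d : ℕ) (hd : Even d) (hd0 : 0 < d) :
    (∀ m : ℝ, 0 < m → List.TFAE
      [m ^ (d - 1) < CirculantSimplex.c (d - 1) m,
        CirculantSimplex.u d m (Fin.last d) < 0,
        ∀ i : Fin (d + 1), (Pi.single i 1 : Fin (d + 1) → ℝ) ∉ CirculantSimplex.S d m,
        ∃ i : Fin (d + 1), (Pi.single i 1 : Fin (d + 1) → ℝ) ∉ CirculantSimplex.S d m,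
        CirculantSimplex.IsEmptySimplex (CirculantSimplex.vertex d m)]) ∧
    (∀ (m : ℤ) (j : Fin (d + 1)),
      CirculantSimplex.IsLatticePoint (CirculantSimplex.vertex d (m : ℝ) j)) ∧
    (∃ m₀ : ℝ, 0 < m₀ ∧
      (∀ m : ℝ, 0 < m → (m ^ (d - 1) = CirculantSimplex.c (d - 1) m ↔ m = m₀)) ∧
      (∀ m : ℝ, 0 < m → (CirculantSimplex.u d m (Fin.last d) = 0 ↔ m = m₀)) ∧
      (∀ m : ℝ, 0 ≤ m → m < m₀ →
        CirculantSimplex.IsEmptySimplex (CirculantSimplex.vertex d m))) := by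
  open CirculantSimplex in
  refine ⟨fun m hm => ?_, isLatticePoint_vertex_intCast d, ?_⟩
  -- Membership of e_i does not depend on i, so "all" and "some" coincide.
  · refine List.tfae_of_forall (1 < fibPoly m⁻¹ d) _ ?_
    simp [pow_lt_c_iff hd0 hm, u_last_neg_iff hd hd0 hm, single_mem_S_iff hd hd0 hm,
      isEmptySimplex_vertex_iff hd hd0 hm]
  · obtain ⟨t, ht, ht1⟩ := exists_fibPoly_eq_one hd hd0
    have key : ∀ m : ℝ, 0 < m → (fibPoly m⁻¹ d = 1 ↔ m = t⁻¹) := by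
      refine fun m hm => ⟨fun h => ?_, fun h => by rw [h, inv_inv, ht1]⟩
      rcases lt_trichotomy m⁻¹ t with h' | h' | h'
      · exact absurd (fibPoly_even_lt (inv_pos.2 hm).le h' hd hd0) (by rw [h, ht1]; exact lt_irrefl _)
      · rw [← h', inv_inv]
      · exact absurd (fibPoly_even_lt ht.le h' hd hd0) (by rw [h, ht1]; exact lt_irrefl _)
    refine ⟨t⁻¹, inv_pos.2 ht, fun m hm => (pow_eq_c_iff hd0 hm).trans (key m hm),
      fun m hm => (u_last_eq_zero_iff hd hd0 hm).trans (key m hm), fun m hm hlt => ?_⟩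
    rcases hm.eq_or_lt with rfl | hm
    · exact isEmptySimplex_vertex_zero (by obtain ⟨r, rfl⟩ := hd; omega)
    · refine isEmptySimplex_vertex_of_pos hd hd0 hm (ht1.symm.trans_lt ?_)
      exact fibPoly_even_lt ht.le ((lt_inv_comm₀ hm ht).1 hlt) hd hd0
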